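/- Let $D\subset\mathbb C$ be a domain (a non-empty, open, connected set) and let $C>0$. Let $\mathcal F_{1,C}(D)$ be the family of all meromorphic functions $f$ in $D$ such that $$\frac{|f'(z)|}{1+|f(z)|}>C\qquad\text{for every } z\in D,$$ where at a pole of $f$ the quotient is given its limit $+\infty$, so that the inequality holds there automatically. Then $\mathcal F_{1,C}(D)$ is quasi-normal in $D$: every sequence in $\mathcal F_{1,C}(D)$ has a subsequence for which there is a set $E\subset D$ without accumulation points in $D$ such that the subsequence converges, in the spherical metric and uniformly on the compact subsets of $D\setminus E$, to a function from $D\setminus E$ to the Riemann sphere $\mathbb C\cup\{\infty\}$. However, $\mathcal F_{1,C}(D)$ need not be normal in $D$ (a family is normal in $D$ if every sequence in it has a subsequence that converges in the spherical metric, uniformly on the compact subsets of $D$): if $D$ is a bounded domain with $0\in D$, then there is a $C>0$ such that all the functions $z\mapsto nz$, $n=1,2,3,\dots$, belong to $\mathcal F_{1,C}(D)$, while the family $\{nz : n\ge 1\}$, and hence $\mathcal F_{1,C}(D)$, is not normal in $D$. -/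

import Mathlib

open Filter Topology

noncomputable section

/-- The chordal distance `χ` on the Riemann sphere `ℂ ∪ {∞}`. -/
def chordalDist : OnePoint ℂ → OnePoint ℂ → ℝ
  | .infty, .infty => 0
  | .infty, .some b => 1 / √(1 + ‖b‖ ^ 2)
  | .some a, .infty => 1 / √(1 + ‖a‖ ^ 2)
  | .some a, .some b => ‖a - b‖ / (√(1 + ‖a‖ ^ 2) * √(1 + ‖b‖ ^ 2))

open Classical in
/-- The value at `z` of a meromorphic function as a point of the Riemann sphere: `∞` at a pole,
and `f z` elsewhere. Functions are always taken in meromorphic normal form below, so that `f` is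
analytic at every point that is not a pole and `f z` is the true value there. -/
def sphereValue (f : ℂ → ℂ) (z : ℂ) : OnePoint ℂ :=
  if meromorphicOrderAt f z < 0 then OnePoint.infty else ((f z : ℂ) : OnePoint ℂ)

/-- Convergence of a sequence of meromorphic functions to `g` in the spherical metric, uniformly
on the compact subsets of `U`. -/
def SphericallyConvergesOn (f : ℕ → ℂ → ℂ) (g : ℂ → OnePoint ℂ) (U : Set ℂ) : Prop :=
  ∀ K : Set ℂ, K ⊆ U → IsCompact K → ∀ ε : ℝ, 0 < ε →
    ∀ᶠ n in atTop, ∀ z ∈ K, chordalDist (sphereValue (f n) z) (g z) < ε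

/-- `F` is a normal family in `D`: every sequence in `F` has a subsequence that converges
in the spherical metric, uniformly on the compact subsets of `D`. -/
def IsNormalFamily (F : Set (ℂ → ℂ)) (D : Set ℂ) : Prop :=
  ∀ f : ℕ → ℂ → ℂ, (∀ n, f n ∈ F) →
    ∃ φ : ℕ → ℕ, StrictMono φ ∧ ∃ g : ℂ → OnePoint ℂ,
      SphericallyConvergesOn (fun n => f (φ n)) g D

/-- `F` is a quasi-normal family in `D`: every sequence in `F` has a subsequence that converges
in the spherical metric, uniformly on the compact subsets of `D \ E`, for some `E ⊆ D`
(depending on the subsequence) without accumulation points in `D`. -/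
def IsQuasiNormalFamily (F : Set (ℂ → ℂ)) (D : Set ℂ) : Prop :=
  ∀ f : ℕ → ℂ → ℂ, (∀ n, f n ∈ F) →
    ∃ φ : ℕ → ℕ, StrictMono φ ∧ ∃ E : Set ℂ, E ⊆ D ∧ (∀ z ∈ D, ¬ AccPt z (𝓟 E)) ∧
      ∃ g : ℂ → OnePoint ℂ, SphericallyConvergesOn (fun n => f (φ n)) g (D \ E)

/-- The family of all meromorphic functions `f` in `D` with `|f'| / (1 + |f|) > C` on `D`.
A meromorphic function is represented by its normal form on `D`. The inequality is required at
the points that are not poles; at a pole the quotient tends to `+∞`, so that it holds there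
automatically. -/
def familyOne (C : ℝ) (D : Set ℂ) : Set (ℂ → ℂ) :=
  {f | MeromorphicNFOn f D ∧
    ∀ z ∈ D, 0 ≤ meromorphicOrderAt f z → C < ‖deriv f z‖ / (1 + ‖f z‖)}

/-- The family of the functions `z ↦ n z`, `n = 1, 2, …`. -/
def linearFamily : Set (ℂ → ℂ) :=
  {f | ∃ n : ℕ, 1 ≤ n ∧ f = fun z => (n : ℂ) * z}

end

/-! The inequality bounds both `h = 1/f'` and `g = f/f'` by `1/C`, so the poles of `f` are removable
for them and Montel's theorem gives locally uniform limits `H` and `G` along a subsequence. Since `f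
= g/h`, the limit of `f` is `G/H` off the zeros of `H` if `H ≢ 0`, and `∞` off the zeros of `G` if
`H ≡ 0` but `G ≢ 0`. If both vanish identically, differentiating `g = f h` gives `g' - 1 = f h'`;
here `g' - 1 → -1` and `h' → 0`, so `f → ∞` on all of `D`. For `nz`, a limit would have to be `∞`
off the origin, while points close to `0` keep values in the unit disc. -/

/-- **Montel's theorem** for a uniformly bounded sequence of holomorphic functions. -/
theorem exists_subseq_tendstoLocallyUniformlyOn_of_bounded {D : Set ℂ} (hD : IsOpen D)
    {F : ℕ → ℂ → ℂ} {B : ℝ} (hd : ∀ n, DifferentiableOn ℂ (F n) D)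
    (hB : ∀ n, ∀ z ∈ D, ‖F n z‖ ≤ B) :
    ∃ φ : ℕ → ℕ, StrictMono φ ∧ ∃ G : ℂ → ℂ,
      TendstoLocallyUniformlyOn (fun n => F (φ n)) G atTop D := by
  have : LocallyCompactSpace D := hD.locallyCompactSpace
  let Φ : ℕ → C(D, ℂ) := fun n => ⟨D.domRestrict (F n), (hd n).continuousOn.domRestrict⟩
  have hequi : Equicontinuous (fun n (x : D) => F n x) := by
    intro x
    obtain ⟨r, hr, hrD⟩ := Metric.isOpen_iff.1 hD x x.2
    -- Schwarz's lemma on the ball of radius `r`, where `F n` deviates from `F n x` by at most `2B`,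
    -- gives a Lipschitz bound independent of `n`.
    refine Metric.equicontinuousAt_of_continuity_modulus
      (fun y : D => (2 * B + 1) / r * dist (y : ℂ) x) ?_ _ ?_
    · have : Continuous (fun y : D => (2 * B + 1) / r * dist (y : ℂ) x) := by fun_prop
      simpa using this.tendsto x
    · filter_upwards [(continuous_subtype_val.continuousAt (x := x)).preimage_mem_nhds
        (Metric.ball_mem_nhds _ hr)] with y hy n
      rw [dist_comm]
      refine Complex.dist_le_div_mul_dist_of_mapsTo_ball ((hd n).mono hrD) (fun z hz => ?_) hy
      rw [Metric.mem_closedBall, dist_eq_norm]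
      linarith [norm_sub_le (F n z) (F n x), hB n z (hrD hz), hB n x x.2]
  have : T2Space (UniformOnFun D ℂ {K : Set D | IsCompact K}) :=
    UniformOnFun.t2Space_of_covering
      (Set.eq_univ_of_forall fun x => Set.mem_sUnion_of_mem (Set.mem_singleton x) isCompact_singleton)
  have hK : IsCompact (closure (Set.range Φ)) := by
    refine ArzelaAscoli.isCompact_closure_of_isClosedEmbedding (𝔖 := {K : Set D | IsCompact K})
      (F := fun f : C(D, ℂ) => (f : D → ℂ)) (fun _ h => h)
      (ContinuousMap.isUniformEmbedding_toUniformOnFunIsCompact.isClosedEmbedding) ?_ ?_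
    · intro K _
      refine Equicontinuous.equicontinuousOn (fun x U hU => ?_) K
      filter_upwards [hequi x U hU] with y hy
      rintro ⟨_, n, rfl⟩
      exact hy n
    · intro K _ x _
      refine ⟨Metric.closedBall 0 B, isCompact_closedBall _ _, ?_⟩
      rintro _ ⟨n, rfl⟩
      exact mem_closedBall_zero_iff.2 (hB n x x.2)
  obtain ⟨G, -, φ, hφ, hG⟩ := hK.tendsto_subseq (fun n => subset_closure (Set.mem_range_self n))
  rw [ContinuousMap.tendsto_iff_tendstoLocallyUniformly] at hG
  refine ⟨φ, hφ, fun z => Function.extend Subtype.val G 0 z, ?_⟩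
  rw [tendstoLocallyUniformlyOn_iff_tendstoLocallyUniformly_comp_coe]
  have hext : (fun z : ℂ => Function.extend Subtype.val G 0 z) ∘ ((↑) : D → ℂ) = G :=
    funext fun x => Subtype.val_injective.extend_apply _ _ _
  rw [hext]
  exact hG

/-- A meromorphic function that is analytic and bounded off a discrete set extends analytically,
with the same bound. -/
theorem exists_differentiableOn_extension {D P : Set ℂ} (hD : IsOpen D) {F : ℂ → ℂ} {B : ℝ}
    (hF : MeromorphicOn F D) (hP : ∀ z ∈ D, ∀ᶠ w in 𝓝[≠] z, w ∉ P)
    (hFa : ∀ z ∈ D, z ∉ P → AnalyticAt ℂ F z ∧ ‖F z‖ ≤ B) :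
    ∃ G : ℂ → ℂ, DifferentiableOn ℂ G D ∧ (∀ z ∈ D, ‖G z‖ ≤ B) ∧ ∀ z ∈ D, z ∉ P → G z = F z := by
  have hb : ∀ z ∈ D, ∀ᶠ w in 𝓝[≠] z, ‖F w‖ ≤ B := fun z hz => by
    filter_upwards [hP z hz, mem_nhdsWithin_of_mem_nhds (hD.mem_nhds hz)] with w hw hwD
    exact (hFa w hwD hw).2
  have hGa : ∀ z ∈ D, AnalyticAt ℂ (toMeromorphicNFOn F D) z := by
    intro z hz
    rw [← (meromorphicNFOn_toMeromorphicNFOn F D hz).meromorphicOrderAt_nonneg_iff_analyticAt,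
      meromorphicOrderAt_toMeromorphicNFOn hF hz]
    by_contra! h
    have h1 := tendsto_norm_atTop_iff_cobounded.2 (tendsto_cobounded_of_meromorphicOrderAt_neg h)
    obtain ⟨w, h1, h2⟩ := ((h1.eventually_gt_atTop B).and (hb z hz)).exists
    linarith
  refine ⟨toMeromorphicNFOn F D, fun z hz => (hGa z hz).differentiableAt.differentiableWithinAt,
    fun z hz => ?_, fun z hz hzP => ?_⟩
  · refine le_of_tendsto (((hGa z hz).continuousAt.norm).tendsto.mono_left nhdsWithin_le_nhds) ?_
      (x := 𝓝[≠] z)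
    filter_upwards [hb z hz, hF.toMeromorphicNFOn_eq_self_on_nhdsNE hz] with w hw h
    rwa [h]
  · rw [toMeromorphicNFOn_eq_toMeromorphicNFAt hF hz,
      toMeromorphicNFAt_eq_self.2 (hFa z hz hzP).1.meromorphicNFAt]

/-! ### Chordal distance and values on the sphere -/

theorem chordalDist_coe_le (a b : ℂ) : chordalDist (a : OnePoint ℂ) b ≤ ‖a - b‖ := by
  refine div_le_self (norm_nonneg _) (one_le_mul_of_one_le_of_one_le ?_ ?_) <;>
    rw [Real.one_le_sqrt] <;> nlinarith [sq_nonneg ‖a‖, sq_nonneg ‖b‖]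

theorem chordalDist_coe_infty (a : ℂ) :
    chordalDist (a : OnePoint ℂ) OnePoint.infty = 1 / √(1 + ‖a‖ ^ 2) := rfl

theorem chordalDist_coe_coe (a b : ℂ) :
    chordalDist (a : OnePoint ℂ) b = ‖a - b‖ / (√(1 + ‖a‖ ^ 2) * √(1 + ‖b‖ ^ 2)) := rfl

theorem chordalDist_coe_infty_lt {a : ℂ} {ε : ℝ} (hε : 0 < ε) (ha : 1 / ε < ‖a‖) :
    chordalDist (a : OnePoint ℂ) OnePoint.infty < ε := by
  have h0 : 0 < 1 / ε := by positivity
  have h1 : 1 / ε < √(1 + ‖a‖ ^ 2) := by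
    refine ha.trans_le (Real.le_sqrt_of_sq_le ?_)
    linarith
  rw [chordalDist_coe_infty]
  exact (one_div_lt (h0.trans h1) hε).2 h1

theorem sphereValue_of_neg {f : ℂ → ℂ} {z : ℂ} (h : meromorphicOrderAt f z < 0) :
    sphereValue f z = OnePoint.infty := if_pos h

theorem sphereValue_of_nonneg {f : ℂ → ℂ} {z : ℂ} (h : 0 ≤ meromorphicOrderAt f z) :
    sphereValue f z = (f z : OnePoint ℂ) := if_neg h.not_gt

theorem IsNormalFamily.mono {F G : Set (ℂ → ℂ)} {D : Set ℂ} (hG : IsNormalFamily G D)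
    (h : F ⊆ G) : IsNormalFamily F D := fun f hf => hG f fun n => h (hf n)

/-! ### The bounded functions `1/f'` and `f/f'` -/

/-- The functions `1 / f'` and `f / f'` attached to a member of `familyOne C D` extend to bounded
holomorphic functions. -/
theorem exists_inv_deriv_extension {D : Set ℂ} (hD : IsOpen D) {C : ℝ} (hC : 0 < C) {f : ℂ → ℂ}
    (hf : f ∈ familyOne C D) :
    ∃ h g : ℂ → ℂ, DifferentiableOn ℂ h D ∧ DifferentiableOn ℂ g D ∧
      (∀ z ∈ D, ‖h z‖ ≤ 1 / C) ∧ (∀ z ∈ D, ‖g z‖ ≤ 1 / C) ∧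
      (∀ z ∈ D, meromorphicOrderAt f z < 0 → h z = 0) ∧
      ∀ z ∈ D, 0 ≤ meromorphicOrderAt f z →
        h z ≠ 0 ∧ g z = f z * h z ∧ deriv g z = 1 + f z * deriv h z := by
  obtain ⟨hNF, hineq⟩ := hf
  have hmer : MeromorphicOn f D := hNF.meromorphicOn
  set P : Set ℂ := {z | meromorphicOrderAt f z < 0} with hPdef
  have hfa : ∀ z ∈ D, z ∉ P → AnalyticAt ℂ f z := fun z hz hzP =>
    (hNF hz).meromorphicOrderAt_nonneg_iff_analyticAt.1 (not_lt.1 hzP)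
  have hP : ∀ z ∈ D, ∀ᶠ w in 𝓝[≠] z, w ∉ P := fun z hz => by
    filter_upwards [(hmer z hz).eventually_analyticAt] with w hw
    exact not_lt.2 hw.meromorphicOrderAt_nonneg
  have hbound : ∀ z ∈ D, z ∉ P → deriv f z ≠ 0 ∧
      (1 + ‖f z‖) * ‖(deriv f z)⁻¹‖ ≤ 1 / C := fun z hz hzP => by
    have h1 := hineq z hz (not_lt.1 hzP)
    have h2 : 0 < 1 + ‖f z‖ := by positivity
    rw [lt_div_iff₀ h2] at h1
    have h3 : 0 < ‖deriv f z‖ := (mul_pos hC h2).trans h1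
    refine ⟨norm_pos_iff.1 h3, ?_⟩
    rw [norm_inv, ← div_eq_mul_inv, div_le_div_iff₀ h3 hC]
    linarith
  have hana : ∀ z ∈ D, z ∉ P → AnalyticAt ℂ (deriv f)⁻¹ z := fun z hz hzP =>
    (hfa z hz hzP).deriv.inv (hbound z hz hzP).1
  obtain ⟨h, hh, hhB, hhe⟩ := exists_differentiableOn_extension (B := 1 / C)
    (F := (deriv f)⁻¹) hD (fun z hz => (hmer z hz).deriv.inv) hP (fun z hz hzP =>
      ⟨hana z hz hzP, by
        have := (hbound z hz hzP).2
        have h2 : 0 ≤ ‖f z‖ * ‖(deriv f z)⁻¹‖ := by positivity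
        rw [Pi.inv_apply]
        linarith⟩)
  obtain ⟨g, hg, hgB, hge⟩ := exists_differentiableOn_extension (B := 1 / C)
    (F := f * (deriv f)⁻¹) hD (fun z hz => (hmer z hz).mul (hmer z hz).deriv.inv) hP
    (fun z hz hzP =>
      ⟨(hfa z hz hzP).mul (hana z hz hzP), by
        have := (hbound z hz hzP).2
        have h2 : 0 ≤ ‖(deriv f z)⁻¹‖ := by positivity
        rw [Pi.mul_apply, Pi.inv_apply, norm_mul]
        linarith⟩)
  refine ⟨h, g, hh, hg, hhB, hgB, fun z hz hzP => ?_, fun z hz hzP => ?_⟩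
  -- Near a pole, `‖1/f'‖ ≤ (1/C)/‖f‖`, which tends to `0`.
  · have hcont : Tendsto h (𝓝[≠] z) (𝓝 (h z)) :=
      ((hh z hz).continuousWithinAt.continuousAt (hD.mem_nhds hz)).tendsto.mono_left
        nhdsWithin_le_nhds
    refine tendsto_nhds_unique hcont (squeeze_zero_norm' (a := fun w => (1 / C) / ‖f w‖) ?_
      (tendsto_const_nhds.div_atTop
        (tendsto_norm_atTop_iff_cobounded.2 (tendsto_cobounded_of_meromorphicOrderAt_neg hzP))))
    filter_upwards [hP z hz, mem_nhdsWithin_of_mem_nhds (hD.mem_nhds hz),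
      (tendsto_norm_atTop_iff_cobounded.2
        (tendsto_cobounded_of_meromorphicOrderAt_neg hzP)).eventually_gt_atTop 0] with w hw hwD hw0
    rw [hhe w hwD hw, le_div_iff₀ hw0, Pi.inv_apply]
    have := (hbound w hwD hw).2
    nlinarith [norm_nonneg (deriv f w)⁻¹]
  · have hzP' : z ∉ P := not_lt.2 hzP
    have h0 := (hbound z hz hzP').1
    have hfz := hfa z hz hzP'
    -- Regular points form an open set, so `g = f h` may be differentiated; then `f' h = 1`.
    have hev : g =ᶠ[𝓝 z] f * h := by
      filter_upwards [hfz.eventually_analyticAt, hD.mem_nhds hz] with w hw hwD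
      have hwP : w ∉ P := not_lt.2 hw.meromorphicOrderAt_nonneg
      rw [hge w hwD hwP, Pi.mul_apply, Pi.mul_apply, hhe w hwD hwP]
    refine ⟨?_, ?_, ?_⟩
    · rw [hhe z hz hzP']
      exact inv_ne_zero h0
    · exact hev.eq_of_nhds
    · rw [hev.deriv_eq, deriv_mul hfz.differentiableAt (hh.differentiableAt (hD.mem_nhds hz)),
        hhe z hz hzP', Pi.inv_apply, mul_inv_cancel₀ h0]

/-! ### Limits of the sequence and quasi-normality -/

/-- The zeros of a holomorphic function that is not identically zero on a domain do not
accumulate in the domain. -/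
theorem not_accPt_zeros {D : Set ℂ} (hD : IsOpen D) (hDc : IsPreconnected D) {F : ℂ → ℂ}
    (hF : DifferentiableOn ℂ F D) (h0 : ¬ Set.EqOn F 0 D) {z : ℂ} (hz : z ∈ D) :
    ¬ AccPt z (𝓟 {w ∈ D | F w = 0}) := by
  intro hacc
  refine h0 ((hF.analyticOnNhd hD).eqOn_zero_of_preconnected_of_frequently_eq_zero hDc hz ?_)
  exact (accPt_iff_frequently_nhdsNE.1 hacc).mono fun w hw => hw.2

theorem IsCompact.exists_forall_le_norm {K : Set ℂ} (hK : IsCompact K) {F : ℂ → ℂ}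
    (hF : ContinuousOn F K) (h0 : ∀ z ∈ K, F z ≠ 0) : ∃ δ > 0, ∀ z ∈ K, δ ≤ ‖F z‖ := by
  rcases K.eq_empty_or_nonempty with rfl | hne
  · exact ⟨1, one_pos, by simp⟩
  · obtain ⟨w, hw, hmin⟩ := hK.exists_isMinOn hne hF.norm
    exact ⟨‖F w‖, norm_pos_iff.2 (h0 w hw), fun z hz => hmin hz⟩

/-- If `u n = a z * v n` off the poles of `f n`, where `v n → 0` and `u n → U`, then `f n → ∞`
away from the zeros of `U`. -/
theorem sphericallyConvergesOn_infty {D S : Set ℂ} {f u v : ℕ → ℂ → ℂ} {U : ℂ → ℂ} (hD : IsOpen D)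
    (hS : S ⊆ D) (huc : ContinuousOn U D) (hU : ∀ z ∈ S, U z ≠ 0)
    (hu : TendstoLocallyUniformlyOn u U atTop D) (hv : TendstoLocallyUniformlyOn v 0 atTop D)
    (hfuv : ∀ n, ∀ z ∈ D, 0 ≤ meromorphicOrderAt (f n) z → u n z = f n z * v n z) :
    SphericallyConvergesOn f (fun _ => OnePoint.infty) S := by
  intro K hKS hK ε hε
  have hKD := hKS.trans hS
  obtain ⟨δ, hδ, hδK⟩ := hK.exists_forall_le_norm (huc.mono hKD) fun z hz => hU z (hKS hz)
  rw [tendstoLocallyUniformlyOn_iff_forall_isCompact hD] at hu hv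
  -- `‖u n‖ > δ/2` and `‖v n‖ < εδ/2` force `‖f n‖ > 1/ε`.
  filter_upwards [Metric.tendstoUniformlyOn_iff.1 (hu K hKD hK) (δ / 2) (half_pos hδ),
    Metric.tendstoUniformlyOn_iff.1 (hv K hKD hK) (δ / 2 * ε) (by positivity)] with n hun hvn z hz
  rcases lt_or_ge (meromorphicOrderAt (f n) z) 0 with h | h
  · rw [sphereValue_of_neg h]
    exact hε
  · rw [sphereValue_of_nonneg h]
    refine chordalDist_coe_infty_lt hε ?_
    have h1 : δ / 2 < ‖u n z‖ := by
      have := hun z hz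
      rw [dist_eq_norm] at this
      linarith [hδK z hz, norm_sub_norm_le (U z) (u n z)]
    have h2 : ‖v n z‖ < δ / 2 * ε := by simpa [dist_eq_norm] using hvn z hz
    rw [hfuv n z (hKD hz) h, norm_mul] at h1
    rw [div_lt_iff₀ hε]
    by_contra! hle
    have h3 : 0 < ‖f n z‖ * ‖v n z‖ := (half_pos hδ).trans h1
    have h4 : 0 < ‖f n z‖ := pos_of_mul_pos_left h3 (norm_nonneg _)
    have h5 : ‖f n z‖ * ‖v n z‖ < ‖f n z‖ * (δ / 2 * ε) := mul_lt_mul_of_pos_left h2 h4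
    nlinarith

/-- On a compact set `H` is bounded away from `0`, so eventually `h n` has no zero there and `f n`
no pole; the Euclidean convergence of `g n / h n` then dominates the chordal one. -/
theorem sphericallyConvergesOn_quotient {D S : Set ℂ} {f g h : ℕ → ℂ → ℂ} {G H : ℂ → ℂ}
    (hD : IsOpen D) (hS : S ⊆ D) (hGc : ContinuousOn G D) (hHc : ContinuousOn H D)
    (hH : ∀ z ∈ S, H z ≠ 0)
    (hg : TendstoLocallyUniformlyOn g G atTop D) (hh : TendstoLocallyUniformlyOn h H atTop D)
    (hpole : ∀ n, ∀ z ∈ D, meromorphicOrderAt (f n) z < 0 → h n z = 0)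
    (hfgh : ∀ n, ∀ z ∈ D, 0 ≤ meromorphicOrderAt (f n) z → h n z ≠ 0 ∧ g n z = f n z * h n z) :
    SphericallyConvergesOn f (fun z => ((G z / H z : ℂ) : OnePoint ℂ)) S := by
  intro K hKS hK ε hε
  have hKD := hKS.trans hS
  obtain ⟨δ, hδ, hδK⟩ := hK.exists_forall_le_norm (hHc.mono hKD) fun z hz => hH z (hKS hz)
  have hq : TendstoUniformlyOn (fun n => g n / h n) (G / H) atTop K := by
    rw [← tendstoLocallyUniformlyOn_iff_tendstoUniformlyOn_of_compact hK]
    exact (hg.mono hKD).div₀ (hh.mono hKD) (hGc.mono hKD) (hHc.mono hKD) fun z hz => hH z (hKS hz)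
  rw [tendstoLocallyUniformlyOn_iff_forall_isCompact hD] at hh
  filter_upwards [Metric.tendstoUniformlyOn_iff.1 (hh K hKD hK) δ hδ,
    Metric.tendstoUniformlyOn_iff.1 hq ε hε] with n hhn hqn z hz
  rcases lt_or_ge (meromorphicOrderAt (f n) z) 0 with hz0 | hz0
  · have := hhn z hz
    rw [hpole n z (hKD hz) hz0, dist_zero_right] at this
    linarith [hδK z hz]
  · obtain ⟨h1, h2⟩ := hfgh n z (hKD hz) hz0
    rw [sphereValue_of_nonneg hz0]
    refine (chordalDist_coe_le _ _).trans_lt ?_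
    have := hqn z hz
    rwa [dist_comm, dist_eq_norm, Pi.div_apply, Pi.div_apply, h2, mul_div_cancel_right₀ _ h1]
      at this

theorem isQuasiNormalFamily_familyOne {D : Set ℂ} (hD : IsOpen D) (hDc : IsPreconnected D) {C : ℝ}
    (hC : 0 < C) : IsQuasiNormalFamily (familyOne C D) D := by
  intro f hf
  choose h g hh hg hhB hgB hpole hreg using fun n => exists_inv_deriv_extension hD hC (hf n)
  obtain ⟨φ, hφ, H, hH⟩ := exists_subseq_tendstoLocallyUniformlyOn_of_bounded hD hh hhB
  obtain ⟨ψ, hψ, G, hG⟩ := exists_subseq_tendstoLocallyUniformlyOn_of_bounded hD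
    (fun n => hg (φ n)) (fun n => hgB (φ n))
  replace hH : TendstoLocallyUniformlyOn (fun n => h (φ (ψ n))) H atTop D :=
    fun s hs x hx => (hH s hs x hx).imp fun t ht => ⟨ht.1, hψ.tendsto_atTop.eventually ht.2⟩
  have hHd : DifferentiableOn ℂ H D := hH.differentiableOn (.of_forall fun n => hh _) hD
  have hGd : DifferentiableOn ℂ G D := hG.differentiableOn (.of_forall fun n => hg _) hD
  refine ⟨φ ∘ ψ, hφ.comp hψ, ?_⟩
  by_cases hH0 : Set.EqOn H 0 D
  · have hH' : TendstoLocallyUniformlyOn (fun n => h (φ (ψ n))) 0 atTop D := hH.congr_right hH0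
    by_cases hG0 : Set.EqOn G 0 D
    -- The pair `g' - 1 = f h'` replaces `g = f h`; its left side has the zero-free limit `-1`, so
    -- no exceptional points arise.
    · refine ⟨∅, Set.empty_subset _, fun z _ => by simp [AccPt], _,
        sphericallyConvergesOn_infty hD Set.sdiff_subset (U := fun _ => -1) (by fun_prop)
          (by simp) (u := fun n z => deriv (g (φ (ψ n))) z - 1)
          (v := fun n => deriv (h (φ (ψ n)))) ?_ ?_ fun n z hz hz0 => ?_⟩
      · have h1 := ((hG.congr_right hG0).deriv (.of_forall fun n => hg _) hD)
        rw [Metric.tendstoLocallyUniformlyOn_iff] at h1 ⊢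
        have hdist : ∀ a : ℂ, dist (-1) (a - 1) = dist 0 a := fun a => by
          rw [dist_eq_norm, dist_eq_norm]
          congr 1
          ring
        simpa [hdist] using h1
      · have h1 := hH'.deriv (.of_forall fun n => hh _) hD
        rw [deriv_zero] at h1
        exact h1
      · exact sub_eq_of_eq_add' (hreg _ z hz hz0).2.2
    · exact ⟨{z ∈ D | G z = 0}, fun z hz => hz.1, fun z hz => not_accPt_zeros hD hDc hGd hG0 hz, _,
        sphericallyConvergesOn_infty hD Set.sdiff_subset hGd.continuousOn
          (fun z hz h0 => hz.2 ⟨hz.1, h0⟩) hG hH' fun n z hz hz0 => (hreg _ z hz hz0).2.1⟩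
  · exact ⟨{z ∈ D | H z = 0}, fun z hz => hz.1, fun z hz => not_accPt_zeros hD hDc hHd hH0 hz, _,
      sphericallyConvergesOn_quotient hD Set.sdiff_subset hGd.continuousOn hHd.continuousOn
        (fun z hz h0 => hz.2 ⟨hz.1, h0⟩) hG hH (fun n => hpole _)
        fun n z hz hz0 => ⟨(hreg _ z hz hz0).1, (hreg _ z hz hz0).2.1⟩⟩

/-! ### Failure of normality for `nz` -/

theorem analyticAt_linear (n : ℕ) (z : ℂ) : AnalyticAt ℂ (fun w : ℂ => (n : ℂ) * w) z :=
  analyticAt_const.mul analyticAt_id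

/-- For `n ≥ 1`, `n/(1 + n‖z‖) ≥ 1/(1 + ‖z‖) ≥ 1/(1 + R) > C`. -/
theorem linearFamily_subset_familyOne {D : Set ℂ} {C R : ℝ} (hR : ∀ z ∈ D, ‖z‖ ≤ R)
    (hC : C * (1 + R) < 1) (hC0 : 0 < C) : linearFamily ⊆ familyOne C D := by
  rintro _ ⟨n, hn, rfl⟩
  refine ⟨fun z _ => (analyticAt_linear n z).meromorphicNFAt, fun z hz _ => ?_⟩
  have hd : deriv (fun w : ℂ => (n : ℂ) * w) z = n := by simp
  have hn' : (1 : ℝ) ≤ n := by exact_mod_cast hn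
  rw [hd, norm_mul, Complex.norm_natCast, lt_div_iff₀ (by positivity)]
  calc C * (1 + n * ‖z‖) ≤ C * (n * (1 + R)) := by
        refine mul_le_mul_of_nonneg_left ?_ hC0.le
        nlinarith [hR z hz]
    _ = n * (C * (1 + R)) := by ring
    _ < n * 1 := by nlinarith
    _ = n := mul_one _

theorem not_isNormalFamily_linearFamily {D : Set ℂ} (hD : IsOpen D) (h0 : (0 : ℂ) ∈ D) :
    ¬ IsNormalFamily linearFamily D := by
  intro hN
  obtain ⟨φ, hφ, g, hg⟩ := hN (fun n z => ((n + 1 : ℕ) : ℂ) * z) fun n => ⟨n + 1, by simp, rfl⟩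
  have hval : ∀ n z, sphereValue (fun w => ((φ n + 1 : ℕ) : ℂ) * w) z =
      ((((φ n + 1 : ℕ) : ℂ) * z : ℂ) : OnePoint ℂ) := fun n z =>
    sphereValue_of_nonneg (analyticAt_linear _ z).meromorphicOrderAt_nonneg
  obtain ⟨r, hr, hrD⟩ := Metric.nhds_basis_closedBall.mem_iff.1 (hD.mem_nhds h0)
  have hconv := hg _ hrD (isCompact_closedBall 0 r)
  have hinf : ∀ z ∈ Metric.closedBall (0 : ℂ) r, z ≠ 0 → g z = OnePoint.infty := by
    intro z hz hz0
    have htop : Tendsto (fun n => ‖((φ n + 1 : ℕ) : ℂ) * z‖) atTop atTop := by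
      simp only [norm_mul, Complex.norm_natCast]
      exact (tendsto_natCast_atTop_atTop.comp
        ((tendsto_add_atTop_nat 1).comp hφ.tendsto_atTop)).atTop_mul_const (norm_pos_iff.2 hz0)
    cases hgz : g z using OnePoint.rec with
    | infty => rfl
    | coe b =>
      exfalso
      have hs : 0 < √(1 + ‖b‖ ^ 2) := by positivity
      -- If `‖a‖ ≥ 2‖b‖ + 1`, then `‖a - b‖ ≥ ‖a‖/2` and `√(1 + ‖a‖²) ≤ 2‖a‖`, so the chordal
      -- distance from `a` to `b` is at least this tolerance.
      obtain ⟨n, hn, hn1⟩ := ((hconv (1 / (4 * √(1 + ‖b‖ ^ 2))) (by positivity)).and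
        (htop.eventually_ge_atTop (2 * ‖b‖ + 1))).exists
      have h1 := hn z hz
      simp only [hval] at h1
      set a := ((φ n + 1 : ℕ) : ℂ) * z
      rw [hgz, chordalDist_coe_coe, div_lt_div_iff₀ (by positivity) (by positivity)] at h1
      have h2 : √(1 + ‖a‖ ^ 2) ≤ 2 * ‖a‖ := by
        rw [Real.sqrt_le_left (by positivity)]
        nlinarith [norm_nonneg b]
      have h3 : ‖a‖ ≤ 2 * ‖a - b‖ := by linarith [norm_sub_norm_le a b]
      nlinarith
  obtain ⟨n, hn⟩ := (hconv (1 / 2) (by norm_num)).exists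
  have hc : (0 : ℝ) < (φ n + 1 : ℕ) := by positivity
  -- A nonzero point of the disc whose image has norm at most `1`, hence chordal distance at least
  -- `1/√2 > 1/2` from `∞`.
  set z : ℂ := ((min r (1 / (φ n + 1 : ℕ)) : ℝ) : ℂ) with hzdef
  have hmin : 0 < min r (1 / ((φ n + 1 : ℕ) : ℝ)) := lt_min hr (by positivity)
  have hzn : ‖z‖ = min r (1 / ((φ n + 1 : ℕ) : ℝ)) := by
    rw [hzdef, Complex.norm_real, Real.norm_of_nonneg hmin.le]
  have hzr : z ∈ Metric.closedBall (0 : ℂ) r := by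
    rw [mem_closedBall_zero_iff, hzn]
    exact min_le_left _ _
  have h1 := hn z hzr
  simp only [hval] at h1
  rw [hinf z hzr (norm_pos_iff.1 (hzn ▸ hmin)), chordalDist_coe_infty,
    div_lt_div_iff₀ (by positivity) two_pos] at h1
  have h2 : ‖((φ n + 1 : ℕ) : ℂ) * z‖ ≤ 1 := by
    rw [norm_mul, Complex.norm_natCast, hzn]
    calc _ ≤ ((φ n + 1 : ℕ) : ℝ) * (1 / ((φ n + 1 : ℕ) : ℝ)) :=
          mul_le_mul_of_nonneg_left (min_le_right _ _) hc.le
      _ = 1 := mul_one_div_cancel hc.ne'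
  have h3 : √(1 + ‖((φ n + 1 : ℕ) : ℂ) * z‖ ^ 2) ≤ 2 := by
    rw [Real.sqrt_le_left two_pos.le]
    nlinarith [norm_nonneg (((φ n + 1 : ℕ) : ℂ) * z)]
  linarith

theorem theorem1 :
    (∀ (D : Set ℂ) (C : ℝ), IsOpen D → IsConnected D → 0 < C →
      IsQuasiNormalFamily (familyOne C D) D) ∧
    (∀ D : Set ℂ, IsOpen D → IsConnected D → Bornology.IsBounded D → (0 : ℂ) ∈ D →
      ∃ C : ℝ, 0 < C ∧ linearFamily ⊆ familyOne C D ∧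
        ¬ IsNormalFamily linearFamily D ∧ ¬ IsNormalFamily (familyOne C D) D) := by
  refine ⟨fun D C hD hDc hC => isQuasiNormalFamily_familyOne hD hDc.isPreconnected hC,
    fun D hD _ hb h0 => ?_⟩
  obtain ⟨R, hR0, hR⟩ := hb.exists_pos_norm_le
  -- Any positive constant below `1/(1 + R)` would serve.
  have hsub : linearFamily ⊆ familyOne (1 / (2 + R)) D :=
    linearFamily_subset_familyOne hR
      (by rw [one_div_mul_eq_div, div_lt_one (by positivity)]; linarith) (by positivity)
  have hN := not_isNormalFamily_linearFamily hD h0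
  exact ⟨1 / (2 + R), by positivity, hsub, hN, fun h => hN (h.mono hsub)⟩
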